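/- Call a property $\varphi(U)$ of (canonically coded) finite sets $U\subseteq\mathbb N$ essential if for every $x\in\mathbb N$ there is a nonempty finite set $A$ with $\min A>x$ such that $\varphi(A)$ holds. For $C\subseteq\mathbb N$ and an infinite $L\subseteq\mathbb N$, a function $g:\mathbb N\to\mathbb N$ is $C$-hypersurjective for $L$ if for every essential $\Sigma^{0,C}_1$ property $\varphi(U)$ and every $y\in L$ there is a finite set $A$ such that $\varphi(A)$ holds and $g(A)=\{y\}$; it is $C$-hypersurjective if it is $C$-hypersurjective for some infinite set $L\subseteq\mathbb N$. Theorem. $\mathsf{RT}^2_2$ admits preservation of hypersurjectivity. That is, for every set $C\subseteq\mathbb N$, every $C$-hypersurjective function $g:\mathbb N\to\mathbb N$ and every $C$-computable coloring $f:[\mathbb N]^2\to 2$ of the two-element subsets of $\mathbb N$, there is an infinite $f$-homogeneous set $H\subseteq\mathbb N$ (i.e. $f$ is constant on $[H]^2$) such that $g$ is $H\oplus C$-hypersurjective. -/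

import Mathlib

namespace Hypersurj

/-- The characteristic function of a set `C` of natural numbers, used as an oracle. -/
noncomputable def oracle (C : Set ℕ) : ℕ →. ℕ :=
  fun n => Part.some (C.indicator 1 n)

/-- The join `A ⊕ B = {2n : n ∈ A} ∪ {2n + 1 : n ∈ B}`. -/
def join (A B : Set ℕ) : Set ℕ :=
  {m | (∃ n ∈ A, m = 2 * n) ∨ (∃ n ∈ B, m = 2 * n + 1)}

/-- The canonical index of a finite set of natural numbers. This is a bijection of the
finite sets with `ℕ`. -/
def finsetCode (A : Finset ℕ) : ℕ := ∑ i ∈ A, 2 ^ i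

/-- `φ(U)`, a property of (coded) finite sets `U`, is `Σ⁰₁` relative to `C`: it has the form
`∃ n, R(U, n)` with `R` a `C`-computable relation. -/
def IsSigma1 (C : Set ℕ) (φ : Finset ℕ → Prop) : Prop :=
  ∃ R : ℕ → ℕ → Bool, ComputableIn₂ {oracle C} R ∧
    ∀ U : Finset ℕ, φ U ↔ ∃ n : ℕ, R (finsetCode U) n = true

/-- `φ(U)` is essential: for every `x` some finite set `A > x` satisfies it. Here `A > x` means
that `A` is nonempty with `min A > x`. -/
def IsEssential (φ : Finset ℕ → Prop) : Prop :=
  ∀ x : ℕ, ∃ A : Finset ℕ, A.Nonempty ∧ (∀ a ∈ A, x < a) ∧ φ A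

/-- `f` is `C`-hypersurjective for `L`. -/
def IsHypersurjectiveFor (C : Set ℕ) (f : ℕ → ℕ) (L : Set ℕ) : Prop :=
  ∀ φ : Finset ℕ → Prop, IsSigma1 C φ → IsEssential φ →
    ∀ y ∈ L, ∃ A : Finset ℕ, A.image f = {y} ∧ φ A

/-- `f` is `C`-hypersurjective: it is so for some infinite set `L`. -/
def IsHypersurjective (C : Set ℕ) (f : ℕ → ℕ) : Prop :=
  ∃ L : Set ℕ, L.Infinite ∧ IsHypersurjectiveFor C f L

/-- A coloring `[ℕ]² → 2` of the two-element subsets of `ℕ`. -/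
abbrev PairColoring : Type := {s : Finset ℕ // s.card = 2} → Fin 2

/-- The coloring `f` is `C`-computable: some `C`-computable binary function gives `f {x, y}` on
all `x < y`. -/
def PairColoring.IsComputableIn (f : PairColoring) (C : Set ℕ) : Prop :=
  ∃ h : ℕ → ℕ → Fin 2, ComputableIn₂ {oracle C} h ∧
    ∀ (x y : ℕ) (hxy : x < y), f ⟨{x, y}, Finset.card_pair hxy.ne⟩ = h x y

/-- `H` is `f`-homogeneous: `f` takes a single color on `[H]²`. -/
def PairColoring.IsHomogeneous (f : PairColoring) (H : Set ℕ) : Prop :=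
  ∃ c : Fin 2, ∀ s : {s : Finset ℕ // s.card = 2}, (s.1 : Set ℕ) ⊆ H → f s = c

end Hypersurj

/-! The homogeneous set comes from Mathias forcing. A condition has one finite homogeneous set `F i`
for each color `i` and a common infinite reservoir `X` such that `g` stays hypersurjective relative
to `X ⊕ C`.

Fix a value `y ∈ L` and one `Σ⁰₁` property for each color. An oracle `Z` is read as a guess of the
color that each number has with almost all of the reservoir. For each guess, search for a
homogeneous extension of some `F i`, inside the side of `Z` for color `i`, that puts a finite set
`u` into property `i`. By `IsHypersurjectiveFor.dichotomy` (compactness plus hypersurjectivity)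
there are two cases. Either every guess succeeds, within a uniform bound, with some `u` on which `g`
is constantly `y`; then thinning the reservoir makes one guess correct and its extension is taken.
Or some guess admits no success with `u` beyond some `x`; such guesses form a nonempty `Π⁰₁` class,
so preservation for weak König's lemma (`IsHypersurjectiveFor.exists_avoiding`) gives one that keeps
hypersurjectivity, and the reservoir shrinks to an infinite side of it. Both times one color is
decided (`Condition.exists_ge_decides`).

The winning color depends on the requirement, so all pairs of properties are treated. A pairing
argument shows that each `y ∈ L` is fully handled by one color, and one color handles infinitely
many `y`. -/

namespace Hypersurj

/-! ### Strings and canonical indices -/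

open Classical in
/-- The characteristic string of `D` on `{0, …, s - 1}`. -/
noncomputable def pre (D : Set ℕ) (s : ℕ) : List Bool :=
  (List.range s).map fun i => decide (i ∈ D)

@[simp] lemma length_pre (D : Set ℕ) (s : ℕ) : (pre D s).length = s := by simp [pre]

lemma getElem?_pre {D : Set ℕ} {s i : ℕ} {b : Bool} :
    (pre D s)[i]? = some b ↔ i < s ∧ (b = true ↔ i ∈ D) := by
  by_cases h : i < s <;> cases b <;> simp [pre, h]

lemma pre_congr {D E : Set ℕ} {s : ℕ} (h : ∀ i < s, i ∈ D ↔ i ∈ E) : pre D s = pre E s := by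
  refine List.map_congr_left fun i hi => ?_
  simp [h i (List.mem_range.1 hi)]

/-- The finite set with canonical index `u`. -/
def bits (u : ℕ) : Set ℕ := {i | u.testBit i = true}

lemma mem_bits {u i : ℕ} : i ∈ bits u ↔ u.testBit i = true := Iff.rfl

lemma primrec₂_pow : Primrec₂ ((· ^ ·) : ℕ → ℕ → ℕ) := Primrec₂.unpaired'.1 Nat.Primrec.pow

lemma primrecRel_bits : PrimrecRel fun i u : ℕ => i ∈ bits u := by
  have h2 : Primrec₂ fun i _u : ℕ => 2 ^ i :=
    primrec₂_pow.comp₂ (Primrec₂.const 2) Primrec₂.left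
  refine PrimrecPred.of_eq (PrimrecRel.comp Primrec.eq
    (Primrec.nat_mod.comp (Primrec.nat_div.comp Primrec.snd h2) (Primrec.const 2))
    (Primrec.const 1)) fun p => ?_
  simp [mem_bits, Nat.testBit_eq_decide_div_mod_eq]

open Classical in
lemma primrec_pre_bits : Primrec₂ fun u s : ℕ => pre (bits u) s := by
  refine Primrec.list_map (Primrec.list_range.comp Primrec.snd) ?_
  have : PrimrecRel fun (p : ℕ × ℕ) (i : ℕ) => i ∈ bits p.1 :=
    primrecRel_bits.comp Primrec.snd (Primrec.fst.comp Primrec.fst)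
  exact this.decide

/-! ### Closure properties of relative `Σ⁰₁` predicates -/

variable {α β : Type*} [Primcodable α] [Primcodable β]

/-- The predicate `P` is `Σ⁰₁` relative to `D`. -/
def SigmaIn (D : Set ℕ) (P : α → Prop) : Prop :=
  ∃ R : α → List Bool → Prop, PrimrecRel R ∧
    -- The stage `s` bounds both oracle use and search; monotonicity lets finitely many stages merge
    -- into their maximum.
    (∀ a s t, s ≤ t → R a (pre D s) → R a (pre D t)) ∧ ∀ a, P a ↔ ∃ s, R a (pre D s)

namespace SigmaIn

variable {D : Set ℕ} {P Q : α → Prop}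

lemma of_eq (hP : SigmaIn D P) (h : ∀ a, P a ↔ Q a) : SigmaIn D Q :=
  (funext fun a => propext (h a) : P = Q) ▸ hP

lemma of_primrec (hP : PrimrecPred P) : SigmaIn D P :=
  ⟨fun a _ => P a, PrimrecPred.comp hP Primrec.fst, fun _ _ _ _ h => h, fun _ => by simp⟩

lemma comp {P : β → Prop} (hP : SigmaIn D P) {f : α → β} (hf : Primrec f) :
    SigmaIn D fun a => P (f a) := by
  obtain ⟨R, hR, hm, h⟩ := hP
  exact ⟨fun a σ => R (f a) σ, hR.comp (hf.comp Primrec.fst) Primrec.snd,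
    fun a => hm (f a), fun a => h (f a)⟩

lemma and (hP : SigmaIn D P) (hQ : SigmaIn D Q) : SigmaIn D fun a => P a ∧ Q a := by
  obtain ⟨R, hR, hm, h⟩ := hP
  obtain ⟨S, hS, hn, k⟩ := hQ
  refine ⟨fun a σ => R a σ ∧ S a σ, PrimrecPred.and hR hS,
    fun a s t hst H => ⟨hm a s t hst H.1, hn a s t hst H.2⟩, fun a => ?_⟩
  simp only [h, k]
  constructor
  · rintro ⟨⟨s, hs⟩, t, ht⟩
    exact ⟨max s t, hm _ _ _ (le_max_left _ _) hs, hn _ _ _ (le_max_right _ _) ht⟩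
  · rintro ⟨s, hs⟩
    exact ⟨⟨s, hs.1⟩, s, hs.2⟩

lemma or (hP : SigmaIn D P) (hQ : SigmaIn D Q) : SigmaIn D fun a => P a ∨ Q a := by
  obtain ⟨R, hR, hm, h⟩ := hP
  obtain ⟨S, hS, hn, k⟩ := hQ
  refine ⟨fun a σ => R a σ ∨ S a σ, PrimrecPred.or hR hS,
    fun a s t hst H => H.imp (hm a s t hst) (hn a s t hst), fun a => ?_⟩
  simp only [h, k, exists_or]

lemma exists_nat {P : α → ℕ → Prop} (hP : SigmaIn D fun p : α × ℕ => P p.1 p.2) :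
    SigmaIn D fun a => ∃ n, P a n := by
  obtain ⟨R, hR, hm, h⟩ := hP
  -- The length of the oracle string also bounds the witness, so the unbounded search is absorbed
  -- into the stage.
  refine ⟨fun a σ => ∃ n < σ.length, R (a, n) σ, ?_, ?_, fun a => ?_⟩
  · have : PrimrecRel fun (n : ℕ) (p : α × List Bool) => R (p.1, n) p.2 :=
      hR.comp ((Primrec.fst.comp Primrec.snd).pair Primrec.fst) (Primrec.snd.comp Primrec.snd)
    refine PrimrecPred.of_eq (PrimrecRel.comp (f := fun p : α × List Bool => List.range p.2.length)
      (g := fun p => p) this.exists_mem_list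
      (Primrec.list_range.comp (Primrec.list_length.comp Primrec.snd)) Primrec.id) fun p => ?_
    simp
  · rintro a s t hst ⟨n, hn, H⟩
    exact ⟨n, by simp at hn ⊢; omega, hm _ _ _ hst H⟩
  · simp only [fun n => h (a, n), length_pre]
    constructor
    · rintro ⟨n, s, hs⟩
      exact ⟨max s (n + 1), n, by simp, hm _ _ _ (le_max_left _ _) hs⟩
    · rintro ⟨s, n, -, hs⟩
      exact ⟨n, s, hs⟩

lemma ex [Inhabited β] {P : α → β → Prop} (hP : SigmaIn D fun p : α × β => P p.1 p.2) :
    SigmaIn D fun a => ∃ b, P a b := by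
  have hf : Primrec fun n : ℕ => (Encodable.decode n : Option β).getD default :=
    Primrec.option_getD_default.comp Primrec.decode
  refine of_eq (exists_nat (P := fun a n => P a ((Encodable.decode n : Option β).getD default))
    (hP.comp (Primrec.fst.pair (hf.comp Primrec.snd)))) fun a => ⟨fun ⟨n, h⟩ => ⟨_, h⟩, ?_⟩
  rintro ⟨b, h⟩
  exact ⟨Encodable.encode b, by simpa using h⟩

lemma forall_lt {P : α → ℕ → Prop} (hP : SigmaIn D fun p : α × ℕ => P p.1 p.2) {f : α → ℕ}
    (hf : Primrec f) : SigmaIn D fun a => ∀ n < f a, P a n := by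
  obtain ⟨R, hR, hm, h⟩ := hP
  refine ⟨fun a σ => ∀ n < f a, R (a, n) σ, ?_, ?_, fun a => ?_⟩
  · have : PrimrecRel fun (n : ℕ) (p : α × List Bool) => R (p.1, n) p.2 :=
      hR.comp ((Primrec.fst.comp Primrec.snd).pair Primrec.fst) (Primrec.snd.comp Primrec.snd)
    refine PrimrecPred.of_eq (PrimrecRel.comp (f := fun p : α × List Bool => List.range (f p.1))
      (g := fun p => p) this.forall_mem_list
      (Primrec.list_range.comp (hf.comp Primrec.fst)) Primrec.id) fun p => ?_
    simp
  · exact fun a s t hst H n hn => hm _ _ _ hst (H n hn)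
  · simp only [fun n => h (a, n)]
    constructor
    · intro H
      choose s hs using H
      refine ⟨(Finset.range (f a)).attach.sup fun n => s n (Finset.mem_range.1 n.2),
        fun n hn => hm _ _ _ ?_ (hs n hn)⟩
      exact Finset.le_sup (f := fun n : Finset.range (f a) => s n (Finset.mem_range.1 n.2))
        (Finset.mem_attach _ ⟨n, Finset.mem_range.2 hn⟩)
    · exact fun ⟨s, hs⟩ n hn => ⟨s, hs n hn⟩

lemma forall_mem_bits {P : α → ℕ → Prop} (hP : SigmaIn D fun p : α × ℕ => P p.1 p.2) {f : α → ℕ}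
    (hf : Primrec f) : SigmaIn D fun a => ∀ n ∈ bits (f a), P a n := by
  have h : SigmaIn D fun a => ∀ n < f a, n ∉ bits (f a) ∨ P a n :=
    forall_lt ((of_primrec (primrecRel_bits.comp Primrec.snd (hf.comp Primrec.fst)).not).or hP) hf
  refine h.of_eq fun a => forall_congr' fun n => ⟨fun H hn => ?_, fun H _ => ?_⟩
  · exact (H ((Nat.lt_two_pow_self).trans_le (Nat.ge_two_pow_of_testBit hn))).resolve_left
      (not_not.2 hn)
  · exact (em _).elim (fun hn => .inr (H hn)) .inl

lemma mem_oracle : SigmaIn D fun n => n ∈ D := by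
  refine ⟨fun n σ => σ[n]? = some true, Primrec.eq.comp
    (Primrec.list_getElem?.comp Primrec.snd Primrec.fst) (Primrec.const _), ?_, fun n => ?_⟩
  · intro a s t hst h
    rw [getElem?_pre] at h ⊢
    exact ⟨h.1.trans_le hst, h.2⟩
  · simp only [getElem?_pre, true_iff, exists_and_right]
    exact ⟨fun h => ⟨⟨n + 1, by simp⟩, h⟩, fun h => h.2⟩

lemma notMem_oracle : SigmaIn D fun n => n ∉ D := by
  refine ⟨fun n σ => σ[n]? = some false, Primrec.eq.comp
    (Primrec.list_getElem?.comp Primrec.snd Primrec.fst) (Primrec.const _), ?_, fun n => ?_⟩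
  · intro a s t hst h
    rw [getElem?_pre] at h ⊢
    exact ⟨h.1.trans_le hst, h.2⟩
  · simp only [getElem?_pre, Bool.false_eq_true, false_iff, exists_and_right]
    exact ⟨fun h => ⟨⟨n + 1, by simp⟩, h⟩, fun h => h.2⟩

open Classical in
/-- There are only countably many predicates that are `Σ⁰₁` relative to `D`. -/
lemma countable (D : Set ℕ) : {P : α → Prop | SigmaIn D P}.Countable := by
  -- A code deciding `R` determines the predicate; `1` encodes `true`.
  refine (Set.countable_range fun (c : Nat.Partrec.Code) (a : α) =>
    ∃ s, 1 ∈ c.eval (Encodable.encode (a, pre D s))).mono ?_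
  rintro P ⟨R, hR, -, h⟩
  have hd : Computable fun p : α × List Bool => decide (R p.1 p.2) := hR.decide.to_comp
  obtain ⟨c, hc⟩ := Nat.Partrec.Code.exists_code.1 hd
  refine ⟨c, funext fun a => propext ?_⟩
  rw [h]
  refine exists_congr fun s => ?_
  by_cases hs : R a (pre D s) <;> simp [hc, hs]

end SigmaIn

/-! ### Relative computability and joins -/

/-- The set `A` is computable relative to `D`. -/
def DeltaIn (D A : Set ℕ) : Prop := SigmaIn D (· ∈ A) ∧ SigmaIn D (· ∉ A)

namespace DeltaIn

variable {A B D : Set ℕ}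

lemma refl (D : Set ℕ) : DeltaIn D D := ⟨.mem_oracle, .notMem_oracle⟩

lemma of_primrec (h : PrimrecPred (· ∈ A)) : DeltaIn D A :=
  ⟨.of_primrec h, .of_primrec h.not⟩

lemma compl (h : DeltaIn D A) : DeltaIn D Aᶜ :=
  ⟨h.2, h.1.of_eq fun _ => by simp⟩

lemma inter (hA : DeltaIn D A) (hB : DeltaIn D B) : DeltaIn D (A ∩ B) := by
  refine ⟨hA.1.and hB.1, (hA.2.or hB.2).of_eq fun n => ?_⟩
  simp only [Set.mem_inter_iff]
  tauto

lemma preimage (hA : DeltaIn D A) {f : ℕ → ℕ} (hf : Primrec f) : DeltaIn D (f ⁻¹' A) :=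
  ⟨hA.1.comp hf, hA.2.comp hf⟩

end DeltaIn

/-- Guess a string `σ` and confirm each of its bits by the `Σ⁰₁` descriptions of `E` and its
complement; a confirmed `σ` is an initial segment of `E`. -/
lemma SigmaIn.trans {D E : Set ℕ} {P : α → Prop} (hP : SigmaIn E P) (hE : DeltaIn D E) :
    SigmaIn D P := by
  obtain ⟨R, hR, hm, h⟩ := hP
  have key : SigmaIn D fun p : α × List Bool =>
      (∀ i < p.2.length, (p.2[i]? = some true ∧ i ∈ E) ∨ (p.2[i]? = some false ∧ i ∉ E)) ∧
        R p.1 p.2 := by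
    have hg : Primrec fun q : (α × List Bool) × ℕ => q.1.2[q.2]? :=
      Primrec.list_getElem?.comp (Primrec.snd.comp Primrec.fst) Primrec.snd
    refine SigmaIn.and (SigmaIn.forall_lt (((of_primrec ?_).and (hE.1.comp Primrec.snd)).or
      ((of_primrec ?_).and (hE.2.comp Primrec.snd))) (Primrec.list_length.comp Primrec.snd))
      (of_primrec hR)
    · exact Primrec.eq.comp hg (Primrec.const _)
    · exact Primrec.eq.comp hg (Primrec.const _)
  refine (SigmaIn.ex (P := fun a (σ : List Bool) => (∀ i < σ.length,
    (σ[i]? = some true ∧ i ∈ E) ∨ (σ[i]? = some false ∧ i ∉ E)) ∧ R a σ) key).of_eq fun a => ?_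
  rw [h]
  constructor
  · rintro ⟨σ, hσ, H⟩
    refine ⟨σ.length, ?_⟩
    convert H
    refine List.ext_getElem? fun i => ?_
    by_cases hi : i < σ.length
    · obtain ⟨h1, h2⟩ | ⟨h1, h2⟩ := hσ i hi
      · rw [h1, getElem?_pre]; simp [hi, h2]
      · rw [h1, getElem?_pre]; simp [hi, h2]
    · rw [List.getElem?_eq_none (by simpa using hi), List.getElem?_eq_none (by simpa using hi)]
  · rintro ⟨s, hs⟩
    refine ⟨pre E s, fun i hi => ?_, hs⟩
    simp only [getElem?_pre]
    rw [length_pre] at hi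
    by_cases h : i ∈ E <;> simp [h, hi]

lemma DeltaIn.trans {A D E : Set ℕ} (hA : DeltaIn E A) (hE : DeltaIn D E) : DeltaIn D A :=
  ⟨hA.1.trans hE, hA.2.trans hE⟩

lemma mem_join {A B : Set ℕ} {n : ℕ} :
    n ∈ join A B ↔ (n % 2 = 0 ∧ n / 2 ∈ A) ∨ (n % 2 = 1 ∧ n / 2 ∈ B) := by
  constructor
  · rintro (⟨k, hk, rfl⟩ | ⟨k, hk, rfl⟩)
    · left; simpa using hk
    · right
      refine ⟨by omega, ?_⟩
      rwa [show (2 * k + 1) / 2 = k by omega]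
  · rintro (⟨h, hk⟩ | ⟨h, hk⟩)
    · exact .inl ⟨_, hk, by omega⟩
    · exact .inr ⟨_, hk, by omega⟩

lemma DeltaIn.join {A B D : Set ℕ} (hA : DeltaIn D A) (hB : DeltaIn D B) :
    DeltaIn D (join A B) := by
  have h2 : Primrec fun n : ℕ => n / 2 := Primrec.nat_div.comp .id (.const 2)
  have hm (k : ℕ) : SigmaIn D fun n : ℕ => n % 2 = k :=
    .of_primrec (Primrec.eq.comp (Primrec.nat_mod.comp .id (.const 2)) (.const k))
  refine ⟨(((hm 0).and (hA.1.comp h2)).or ((hm 1).and (hB.1.comp h2))).of_eq fun n =>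
    mem_join.symm, (((hm 0).and (hA.2.comp h2)).or ((hm 1).and (hB.2.comp h2))).of_eq fun n => ?_⟩
  rw [mem_join]
  obtain h | h := Nat.mod_two_eq_zero_or_one n <;> simp [h]

lemma deltaIn_join_left (A B : Set ℕ) : DeltaIn (join A B) A := by
  have h : DeltaIn (join A B) ((fun n => 2 * n) ⁻¹' join A B) :=
    (DeltaIn.refl _).preimage (Primrec.nat_mul.comp (.const 2) .id)
  convert h
  ext n
  simp [mem_join]

lemma deltaIn_join_right (A B : Set ℕ) : DeltaIn (join A B) B := by
  have h : DeltaIn (join A B) ((fun n => 2 * n + 1) ⁻¹' join A B) :=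
    (DeltaIn.refl _).preimage (Primrec.succ.comp (Primrec.nat_mul.comp (.const 2) .id))
  convert h
  ext n
  have h1 : (2 * n + 1) / 2 = n := by omega
  have h2 : (2 * n + 1) % 2 = 1 := by omega
  simp [mem_join, h1, h2]

/-- A predicate that is `Σ⁰₁` relative to `H ⊕ D` holds iff some initial segment of `H` forces
it, in a way that is `Σ⁰₁` relative to `D` and does not depend on `H`. -/
lemma SigmaIn.exists_of_join {H D : Set ℕ} {P : α → Prop} (hP : SigmaIn (join H D) P) :
    ∃ Φ : List Bool × α → Prop, SigmaIn D Φ ∧ ∀ a, P a ↔ ∃ s, Φ (pre H s, a) := by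
  obtain ⟨R, hR, hm, h⟩ := hP
  -- Bit `i` of the guess `τ` for the join is checked against `σ` at even places and against `D` at
  -- odd ones.
  let K : List Bool → List Bool → ℕ → Prop := fun τ σ i =>
    (i % 2 = 0 ∧ i / 2 < σ.length ∧ τ[i]? = σ[i / 2]?) ∨
      (i % 2 = 1 ∧ ((τ[i]? = some true ∧ i / 2 ∈ D) ∨ (τ[i]? = some false ∧ i / 2 ∉ D)))
  have hK : SigmaIn D fun q : ((List Bool × α) × List Bool) × ℕ => K q.1.2 q.1.1.1 q.2 := by
    have h2 : Primrec fun q : ((List Bool × α) × List Bool) × ℕ => q.2 / 2 :=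
      Primrec.nat_div.comp .snd (.const 2)
    have hm (k : ℕ) : SigmaIn D fun q : ((List Bool × α) × List Bool) × ℕ => q.2 % 2 = k :=
      .of_primrec (Primrec.eq.comp (Primrec.nat_mod.comp .snd (.const 2)) (.const k))
    have hσ : Primrec fun q : ((List Bool × α) × List Bool) × ℕ => q.1.1.1 :=
      Primrec.fst.comp (Primrec.fst.comp .fst)
    have hτ : Primrec fun q : ((List Bool × α) × List Bool) × ℕ => q.1.2[q.2]? :=
      Primrec.list_getElem?.comp (Primrec.snd.comp .fst) .snd
    have hb (b : Option Bool) :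
        SigmaIn D fun q : ((List Bool × α) × List Bool) × ℕ => q.1.2[q.2]? = b :=
      .of_primrec (Primrec.eq.comp hτ (.const b))
    have hD := DeltaIn.refl D
    refine ((hm 0).and ((of_primrec ?_).and (of_primrec ?_))).or ((hm 1).and
      (((hb _).and (hD.1.comp h2)).or ((hb _).and (hD.2.comp h2))))
    · exact Primrec.nat_lt.comp h2 (Primrec.list_length.comp hσ)
    · exact Primrec.eq.comp hτ (Primrec.list_getElem?.comp hσ h2)
  refine ⟨fun p => ∃ τ : List Bool, (∀ i < τ.length, K τ p.1 i) ∧ R p.2 τ,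
    ex (P := fun (p : List Bool × α) τ => (∀ i < τ.length, K τ p.1 i) ∧ R p.2 τ)
      ((forall_lt (P := fun (q : (List Bool × α) × List Bool) i => K q.2 q.1.1 i) hK
        (Primrec.list_length.comp .snd)).and
      (of_primrec (hR.comp (Primrec.snd.comp .fst) .snd))), fun a => ?_⟩
  rw [h]
  constructor
  · rintro ⟨s, hs⟩
    refine ⟨s, pre (join H D) s, fun i hi => ?_, hs⟩
    rw [length_pre] at hi
    simp only [K, length_pre]
    obtain hi2 | hi2 := Nat.mod_two_eq_zero_or_one i
    · refine .inl ⟨hi2, by omega, Option.ext fun b => ?_⟩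
      rw [getElem?_pre, getElem?_pre, mem_join]
      simp [hi2, hi, show i / 2 < s by omega]
    · refine .inr ⟨hi2, ?_⟩
      rw [getElem?_pre, getElem?_pre, mem_join]
      by_cases hd : i / 2 ∈ D <;> simp [hi2, hi, hd]
  · rintro ⟨s, τ, hτ, H'⟩
    refine ⟨τ.length, ?_⟩
    convert H'
    refine List.ext_getElem? fun i => ?_
    by_cases hi : i < τ.length
    · obtain ⟨h1, h2, h3⟩ | ⟨h1, ⟨h2, h3⟩ | ⟨h2, h3⟩⟩ := hτ i hi
      · refine Option.ext fun b => ?_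
        rw [length_pre] at h2
        rw [h3, getElem?_pre, getElem?_pre, mem_join]
        simp [h1, hi, h2]
      · rw [h2, getElem?_pre, mem_join]; simp [hi, h1, h3]
      · rw [h2, getElem?_pre, mem_join]; simp [hi, h1, h3]
    · rw [List.getElem?_eq_none (by simpa using hi), List.getElem?_eq_none (by simpa using hi)]

/-! ### Agreement with oracle computability -/

open Encodable

/-- Induction on the construction of `F`. For primitive recursion the witness is the list of
intermediate values. -/
lemma SigmaIn.graph_of_nat {D : Set ℕ} {F : ℕ →. ℕ} (hF : Nat.RecursiveIn {oracle D} F) :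
    SigmaIn D fun p : ℕ × ℕ => p.2 ∈ F p.1 := by
  have tot {f : ℕ → ℕ} (hf : Primrec f) : SigmaIn D fun p : ℕ × ℕ => p.2 = f p.1 :=
    .of_primrec (Primrec.eq.comp .snd (hf.comp .fst))
  induction hF with
  | zero => exact (tot (.const 0)).of_eq fun p => by simp [show (0 : Part ℕ) = Part.some 0 from rfl]
  | succ => exact (tot .succ).of_eq fun p => by simp
  | left => exact (tot (Primrec.fst.comp .unpair)).of_eq fun p => by simp
  | right => exact (tot (Primrec.snd.comp .unpair)).of_eq fun p => by simp
  | oracle g hg =>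
    obtain rfl := hg
    have hc (k : ℕ) : SigmaIn D fun p : ℕ × ℕ => p.2 = k := tot (.const k)
    refine (((mem_oracle.comp .fst).and (hc 1)).or ((notMem_oracle.comp .fst).and (hc 0))).of_eq
      fun p => ?_
    by_cases h : p.1 ∈ D <;> simp [oracle, h]
  | @pair f h _ _ ihf ihh =>
    refine ((ihf.comp (f := fun p : ℕ × ℕ => (p.1, p.2.unpair.1)) ?_).and
      (ihh.comp (f := fun p : ℕ × ℕ => (p.1, p.2.unpair.2)) ?_)).of_eq fun p => ?_
    · exact Primrec.fst.pair (Primrec.fst.comp (Primrec.unpair.comp .snd))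
    · exact Primrec.fst.pair (Primrec.snd.comp (Primrec.unpair.comp .snd))
    · simp only [Part.map_eq_map, seq_eq_bind_map, Part.bind_eq_bind, Part.mem_bind_iff,
        Part.mem_map_iff]
      constructor
      · rintro ⟨h1, h2⟩
        exact ⟨_, ⟨_, h1, rfl⟩, _, h2, by simp⟩
      · rintro ⟨_, ⟨a, h1, rfl⟩, b, h2, h3⟩
        rw [← h3]
        simpa using ⟨h1, h2⟩
  | @comp f h _ _ ihf ihh =>
    refine (SigmaIn.exists_nat (P := fun (p : ℕ × ℕ) k => k ∈ h p.1 ∧ p.2 ∈ f k)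
      ((ihh.comp (f := fun q : (ℕ × ℕ) × ℕ => (q.1.1, q.2)) ?_).and
        (ihf.comp (f := fun q : (ℕ × ℕ) × ℕ => (q.2, q.1.2)) ?_))).of_eq fun p => ?_
    · exact (Primrec.fst.comp .fst).pair .snd
    · exact Primrec.snd.pair (Primrec.snd.comp .fst)
    · exact Part.mem_bind_iff.symm
  | @prec f h _ _ ihf ihh =>
    have key : SigmaIn D fun q : (ℕ × ℕ) × List ℕ =>
        q.2.getD 0 0 ∈ f q.1.1.unpair.1 ∧ (∀ i < q.1.1.unpair.2,
          q.2.getD (i + 1) 0 ∈ h (Nat.pair q.1.1.unpair.1 (Nat.pair i (q.2.getD i 0)))) ∧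
        q.1.2 = q.2.getD q.1.1.unpair.2 0 := by
      have hu : Primrec fun q : (ℕ × ℕ) × List ℕ => q.1.1.unpair :=
        Primrec.unpair.comp (Primrec.fst.comp .fst)
      refine (ihf.comp (f := fun q : (ℕ × ℕ) × List ℕ => (q.1.1.unpair.1, q.2.getD 0 0)) ?_).and
        ((SigmaIn.forall_lt (P := fun (q : (ℕ × ℕ) × List ℕ) i => q.2.getD (i + 1) 0 ∈
          h (Nat.pair q.1.1.unpair.1 (Nat.pair i (q.2.getD i 0)))) (ihh.comp (f := fun
            r : ((ℕ × ℕ) × List ℕ) × ℕ => (Nat.pair r.1.1.1.unpair.1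
              (Nat.pair r.2 (r.1.2.getD r.2 0)), r.1.2.getD (r.2 + 1) 0)) ?_)
          (Primrec.snd.comp hu)).and (.of_primrec ?_))
      · exact (Primrec.fst.comp hu).pair ((Primrec.list_getD 0).comp .snd (.const 0))
      · have hl : Primrec fun r : ((ℕ × ℕ) × List ℕ) × ℕ => r.1.2 := Primrec.snd.comp .fst
        exact (Primrec₂.natPair.comp (Primrec.fst.comp (hu.comp .fst)) (Primrec₂.natPair.comp .snd
          ((Primrec.list_getD 0).comp hl .snd))).pair
            ((Primrec.list_getD 0).comp hl (Primrec.succ.comp .snd))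
      · exact Primrec.eq.comp (Primrec.snd.comp .fst)
          ((Primrec.list_getD 0).comp .snd (Primrec.snd.comp hu))
    refine (SigmaIn.ex (P := fun (p : ℕ × ℕ) (l : List ℕ) => l.getD 0 0 ∈ f p.1.unpair.1 ∧
      (∀ i < p.1.unpair.2,
        l.getD (i + 1) 0 ∈ h (Nat.pair p.1.unpair.1 (Nat.pair i (l.getD i 0)))) ∧
      p.2 = l.getD p.1.unpair.2 0) key).of_eq fun p => ?_
    obtain ⟨p, m⟩ := p
    simp only
    generalize p.unpair.1 = a
    generalize p.unpair.2 = n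
    induction n generalizing m with
    | zero =>
      simp only [Nat.not_lt_zero, false_implies, implies_true, true_and]
      exact ⟨fun ⟨l, h1, h2⟩ => h2 ▸ h1, fun h => ⟨[m], by simpa using h, by simp⟩⟩
    | succ n ih =>
      simp only [Part.bind_eq_bind, Part.mem_bind_iff]
      constructor
      · rintro ⟨l, h1, h2, h3⟩
        exact ⟨l.getD n 0, (ih _).1 ⟨l, h1, fun i hi => h2 i (by omega), rfl⟩,
          h3 ▸ h2 n (by omega)⟩
      · rintro ⟨k, hk, hm⟩
        obtain ⟨l, h1, h2, h3⟩ := (ih _).2 hk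
        have hg (i : ℕ) : ((List.range (n + 1)).map (fun i => l.getD i 0) ++ [m]).getD i 0 =
            if i ≤ n then l.getD i 0 else if i = n + 1 then m else 0 := by
          rcases lt_trichotomy i (n + 1) with hi | rfl | hi
          · rw [List.getD_append _ _ _ _ (by simpa using hi)]
            simp [List.getD_eq_getElem?_getD, hi, Nat.le_of_lt_succ hi]
          · rw [List.getD_append_right _ _ _ _ (by simp)]
            simp
          · rw [List.getD_eq_default _ _ (by simpa using hi)]
            simp [show ¬ i ≤ n by omega, show i ≠ n + 1 by omega]
        refine ⟨(List.range (n + 1)).map (fun i => l.getD i 0) ++ [m], ?_, fun i hi => ?_, ?_⟩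
        · rw [hg]; simpa using h1
        · rw [hg, hg, if_pos (show i ≤ n by omega)]
          rcases (show i < n ∨ i = n by omega) with hi | rfl
          · rw [if_pos (by omega)]
            exact h2 i hi
          · rw [if_neg (by omega), if_pos rfl, ← h3]
            exact hm
        · rw [hg]; simp
  | @rfind f _ ih =>
    have h0 : SigmaIn D fun p : ℕ × ℕ => 0 ∈ f (Nat.pair p.1 p.2) :=
      ih.comp (f := fun p : ℕ × ℕ => (Nat.pair p.1 p.2, 0)) (Primrec.pair Primrec₂.natPair (.const 0))
    have h1 : SigmaIn D fun q : (ℕ × ℕ) × ℕ => ∃ v, v ≠ 0 ∧ v ∈ f (Nat.pair q.1.1 q.2) := by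
      refine SigmaIn.exists_nat (P := fun (q : (ℕ × ℕ) × ℕ) v => v ≠ 0 ∧
        v ∈ f (Nat.pair q.1.1 q.2)) ((SigmaIn.of_primrec ?_).and (ih.comp (f := fun
          r : ((ℕ × ℕ) × ℕ) × ℕ => (Nat.pair r.1.1.1 r.1.2, r.2)) ?_))
      · exact (Primrec.eq.comp .snd (.const 0)).not
      · exact (Primrec₂.natPair.comp (Primrec.fst.comp (Primrec.fst.comp .fst))
          (Primrec.snd.comp .fst)).pair .snd
    refine (h0.and (SigmaIn.forall_lt (P := fun (p : ℕ × ℕ) k => ∃ v, v ≠ 0 ∧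
      v ∈ f (Nat.pair p.1 k)) h1 Primrec.snd)).of_eq fun p => ?_
    refine Iff.trans (and_congr ?_ (forall₂_congr fun k _ => ?_)) Nat.mem_rfind.symm
    · simp
    · simp only [Part.map_eq_map, Part.mem_map_iff, decide_eq_false_iff_not]
      exact exists_congr fun v => and_comm

lemma SigmaIn.graph {D : Set ℕ} {f : α → β} (hf : ComputableIn {oracle D} f) :
    SigmaIn D fun p : α × β => f p.1 = p.2 := by
  refine ((SigmaIn.graph_of_nat hf).comp (f := fun p : α × β => (encode p.1, encode p.2))
    ((Primrec.encode.comp .fst).pair (Primrec.encode.comp .snd))).of_eq fun p => ?_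
  simp [eq_comm]

lemma finsetCode_testBit (A : Finset ℕ) (i : ℕ) : (finsetCode A).testBit i = true ↔ i ∈ A := by
  rw [finsetCode, ← Nat.mem_bitIndices, ← List.mem_toFinset, Finset.toFinset_bitIndices_sum_two_pow]

lemma bits_finsetCode (A : Finset ℕ) : bits (finsetCode A) = A :=
  Set.ext fun i => finsetCode_testBit A i

lemma exists_finsetCode (u : ℕ) : ∃ A : Finset ℕ, finsetCode A = u :=
  ⟨u.bitIndices.toFinset, by simp [finsetCode]⟩

lemma IsSigma1.sigmaIn {D : Set ℕ} {φ : Finset ℕ → Prop} (h : IsSigma1 D φ) :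
    ∃ P : ℕ → Prop, SigmaIn D P ∧ ∀ U, φ U ↔ P (finsetCode U) := by
  obtain ⟨R, hR, hφ⟩ := h
  refine ⟨fun u => ∃ n, R u n = true, SigmaIn.exists_nat (P := fun u n => R u n = true)
    ((SigmaIn.graph hR).comp (f := fun p => (p, true)) (.pair .id (.const true))), hφ⟩

lemma recursiveIn_pre (D : Set ℕ) :
    Nat.RecursiveIn {oracle D} fun s => Part.some (encode (pre D s)) := by
  let J : ℕ → ℕ := fun n =>
    encode (((decode n.unpair.1 : Option (List Bool)).getD []) ++ [n.unpair.2 == 1])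
  have hJ : Primrec J := by
    refine Primrec.encode.comp (Primrec.list_append.comp (Primrec.option_getD.comp
      (Primrec.decode.comp (Primrec.fst.comp .unpair)) (.const [])) (Primrec.list_cons.comp
      (Primrec.beq.comp (Primrec.snd.comp .unpair) (.const 1)) (.const [])))
  have hJ' : Nat.RecursiveIn {oracle D} fun n => Part.some (J n) :=
    (Nat.Partrec.of_primrec (Primrec.nat_iff.1 hJ)).recursiveIn
  have hz : Nat.RecursiveIn {oracle D} fun _ => Part.some (encode ([] : List Bool)) :=
    (Nat.Partrec.of_primrec (Nat.Primrec.const _)).recursiveIn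
  -- Primitive recursion expects a parameter paired with the counter; here the parameter is a dummy
  -- `0`.
  have hs : Nat.RecursiveIn {oracle D} fun n => Part.some (Nat.pair 0 n) :=
    (Nat.Partrec.of_primrec (Primrec.nat_iff.1
      (Primrec₂.natPair.comp (.const 0) .id))).recursiveIn
  have ho : Nat.RecursiveIn {oracle D} (oracle D) := .oracle _ rfl
  have hi : Nat.RecursiveIn {oracle D} fun n => Part.some n.unpair.2.unpair.2 :=
    (Nat.Partrec.of_primrec (Primrec.nat_iff.1
      (Primrec.snd.comp (Primrec.unpair.comp (Primrec.snd.comp .unpair))))).recursiveIn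
  have hy : Nat.RecursiveIn {oracle D} fun n => Part.some n.unpair.2.unpair.1 :=
    (Nat.Partrec.of_primrec (Primrec.nat_iff.1
      (Primrec.fst.comp (Primrec.unpair.comp (Primrec.snd.comp .unpair))))).recursiveIn
  refine ((hz.prec (hJ'.comp (hi.pair (ho.comp hy)))).comp hs).of_eq
    fun s => ?_
  simp only [Part.bind_eq_bind, Part.bind_some, Nat.unpair_pair]
  induction s with
  | zero => simp [pre]
  | succ s ih =>
    simp only [ih, Part.bind_some]
    have : (Part.some s >>= fun n => oracle D n) = Part.some (D.indicator 1 s) := Part.bind_some _ _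
    erw [this]
    by_cases h : s ∈ D <;> simp [J, h, pre, List.range_succ, Seq.seq]

open Classical in
lemma SigmaIn.isSigma1 {D : Set ℕ} {P : ℕ → Prop} (h : SigmaIn D P) :
    IsSigma1 D fun U => P (finsetCode U) := by
  obtain ⟨R, hR, -, h⟩ := h
  refine ⟨fun u s => decide (R u (pre D s)), ?_, fun U => by simp [h]⟩
  have hd : Nat.Partrec fun n => Part.bind ↑(decode (α := ℕ × List Bool) n) fun p : ℕ × List Bool =>
      Part.some (encode (decide (R p.1 p.2))) := (hR.decide.to_comp.of_eq fun _ => rfl)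
  refine ((hd.recursiveIn (O := {oracle D})).comp (Nat.RecursiveIn.left.pair
    ((recursiveIn_pre D).comp Nat.RecursiveIn.right))).of_eq fun n => ?_
  simp [Seq.seq]

lemma bits_nonempty {u : ℕ} : (bits u).Nonempty ↔ u ≠ 0 := by
  constructor
  · rintro ⟨i, hi⟩ rfl
    simp [mem_bits] at hi
  · exact Nat.exists_testBit_of_ne_zero

lemma finsetCode_ne_zero {A : Finset ℕ} : finsetCode A ≠ 0 ↔ A.Nonempty := by
  rw [← bits_nonempty, bits_finsetCode, Finset.coe_nonempty]

open Classical in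
-- Turns quantification over all oracles, with use at most `n`, into a bounded quantifier.
lemma exists_bits_eq (Z : Set ℕ) (n : ℕ) : ∃ z < 2 ^ n, ∀ i, i ∈ bits z ↔ i < n ∧ i ∈ Z := by
  have h (i : ℕ) : i ∈ bits (finsetCode ((Finset.range n).filter (· ∈ Z))) ↔ i < n ∧ i ∈ Z := by
    simp [bits_finsetCode]
  refine ⟨_, Nat.lt_pow_two_of_testBit _ fun i hi => ?_, h⟩
  by_contra hb
  exact absurd ((h i).1 (by simpa [mem_bits] using hb)).1 (by omega)

lemma image_eq_singleton {g : ℕ → ℕ} {A : Finset ℕ} {y : ℕ} :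
    A.image g = {y} ↔ A.Nonempty ∧ ∀ a ∈ A, g a = y := by
  rw [Finset.eq_singleton_iff_nonempty_unique_mem]
  simp

/-! ### Hypersurjectivity, compactness and weak König's lemma -/

lemma isHypersurjectiveFor_iff {D : Set ℕ} {g : ℕ → ℕ} {L : Set ℕ} :
    IsHypersurjectiveFor D g L ↔ ∀ P : ℕ → Prop, SigmaIn D P → ∀ y ∈ L,
      (∃ u, u ≠ 0 ∧ (∀ i ∈ bits u, g i = y) ∧ P u) ∨
        ∃ x, ∀ u, u ≠ 0 → (∀ i ∈ bits u, x < i) → ¬ P u := by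
  constructor
  · intro h P hP y hy
    refine or_iff_not_imp_right.2 fun hn => ?_
    push Not at hn
    have hess : IsEssential fun U => P (finsetCode U) := fun x => by
      obtain ⟨u, hu, hx, hP⟩ := hn x
      obtain ⟨A, rfl⟩ := exists_finsetCode u
      exact ⟨A, finsetCode_ne_zero.1 hu, by simpa [bits_finsetCode] using hx, hP⟩
    obtain ⟨A, hA, hPA⟩ := h _ hP.isSigma1 hess y hy
    obtain ⟨h1, h2⟩ := image_eq_singleton.1 hA
    exact ⟨_, finsetCode_ne_zero.2 h1, by simpa [bits_finsetCode] using h2, hPA⟩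
  · intro h φ hφ hess y hy
    obtain ⟨P, hP, hφ⟩ := hφ.sigmaIn
    obtain ⟨u, hu, hg, hPu⟩ | ⟨x, hx⟩ := h P hP y hy
    · obtain ⟨A, rfl⟩ := exists_finsetCode u
      refine ⟨A, image_eq_singleton.2 ⟨finsetCode_ne_zero.1 hu, ?_⟩, (hφ A).2 hPu⟩
      simpa [bits_finsetCode] using hg
    · obtain ⟨A, hA, hxA, hφA⟩ := hess x
      exact absurd ((hφ A).1 hφA) (hx _ (finsetCode_ne_zero.2 hA)
        (by simpa [bits_finsetCode] using hxA))

lemma IsHypersurjectiveFor.of_deltaIn {D E : Set ℕ} {g : ℕ → ℕ} {L : Set ℕ}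
    (h : IsHypersurjectiveFor D g L) (hE : DeltaIn D E) : IsHypersurjectiveFor E g L :=
  isHypersurjectiveFor_iff.2 fun P hP => isHypersurjectiveFor_iff.1 h P (hP.trans hE)

/-- Compactness of Cantor space: a decreasing sequence of nonempty closed classes has a common
member. -/
lemma exists_avoiding {B : ℕ → List Bool → Prop} (hB : ∀ k σ, B k σ → B (k + 1) σ)
    (h : ∀ k, ∃ Z : Set ℕ, ∀ s, ¬ B k (pre Z s)) : ∃ Z : Set ℕ, ∀ k s, ¬ B k (pre Z s) := by
  have hpre (z : ℕ → Bool) (s : ℕ) :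
      pre {i | z i = true} s = List.ofFn fun i : Fin s => z i := by
    refine List.ext_getElem? fun i => Option.ext fun b => ?_
    rw [getElem?_pre]
    by_cases hi : i < s <;> cases b <;> simp [hi]
  let t (k : ℕ) : Set (ℕ → Bool) := {z | ∀ s, ¬ B k (pre {i | z i = true} s)}
  have hcl (k : ℕ) : IsClosed (t k) := by
    simp only [t, hpre, Set.ofPred_forall]
    refine isClosed_iInter fun s => ?_
    have hc : Continuous fun (z : ℕ → Bool) (i : Fin s) => z i := by fun_prop
    exact (isClosed_discrete {w : Fin s → Bool | ¬ B k (List.ofFn w)}).preimage hc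
  have hne (k : ℕ) : (t k).Nonempty := by
    classical
    obtain ⟨Z, hZ⟩ := h k
    exact ⟨fun i => decide (i ∈ Z), by simpa [t] using hZ⟩
  obtain ⟨z, hz⟩ := IsCompact.nonempty_iInter_of_sequence_nonempty_isCompact_isClosed t
    (fun k z hz s hs => hz s (hB _ _ hs)) hne (hcl 0).isCompact hcl
  exact ⟨_, fun k => Set.mem_iInter.1 hz k⟩

/-- Without a bound, the closed classes avoiding `B` up to length `n` would be nonempty and
decreasing, and a common member would avoid `B`. -/
lemma exists_bound_of_forall_exists {B : List Bool → Prop} (h : ∀ Z : Set ℕ, ∃ s, B (pre Z s)) :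
    ∃ n, ∀ Z : Set ℕ, ∃ s ≤ n, B (pre Z s) := by
  by_contra hn
  push Not at hn
  obtain ⟨Z, hZ⟩ := exists_avoiding (B := fun n σ => σ.length ≤ n ∧ B σ)
    (fun k σ hσ => ⟨by omega, hσ.2⟩) fun n => by
      obtain ⟨Z, hZ⟩ := hn n
      exact ⟨Z, fun s hs => hZ s (by simpa using hs.1) hs.2⟩
  obtain ⟨s, hs⟩ := h Z
  exact hZ s s ⟨by simp, hs⟩

/-- Either `Ψ` is met with value `y` along every oracle, within bounded use, or some oracle avoids
`Ψ` for all sufficiently large finite sets. -/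
lemma IsHypersurjectiveFor.dichotomy {D : Set ℕ} {g : ℕ → ℕ} {L : Set ℕ}
    (hD : IsHypersurjectiveFor D g L) {Ψ : List Bool × ℕ → Prop} (hΨ : SigmaIn D Ψ) {y : ℕ}
    (hy : y ∈ L) :
    (∃ n, ∀ Z : Set ℕ, ∃ s ≤ n, ∃ u, u ≠ 0 ∧ (∀ i ∈ bits u, g i = y) ∧ Ψ (pre Z s, u)) ∨
      ∃ x, ∃ Z : Set ℕ, ∀ s u, u ≠ 0 → (∀ i ∈ bits u, x < i) → ¬ Ψ (pre Z s, u) := by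
  let K : ((ℕ × ℕ) × ℕ) × (ℕ × ℕ) → Prop := fun q =>
    q.2.1 ≤ q.1.1.2 ∧ q.2.2 ≠ 0 ∧ (∀ i ∈ bits q.2.2, i ∈ bits q.1.1.1) ∧
      Ψ (pre (bits q.1.2) q.2.1, q.2.2)
  have hK : SigmaIn D K := by
    have hs : Primrec fun q : ((ℕ × ℕ) × ℕ) × (ℕ × ℕ) => q.2.1 := Primrec.fst.comp .snd
    have hu : Primrec fun q : ((ℕ × ℕ) × ℕ) × (ℕ × ℕ) => q.2.2 := Primrec.snd.comp .snd
    have hz : Primrec fun q : ((ℕ × ℕ) × ℕ) × (ℕ × ℕ) => q.1.2 := Primrec.snd.comp .fst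
    have hU : Primrec fun q : ((ℕ × ℕ) × ℕ) × (ℕ × ℕ) => q.1.1.1 :=
      Primrec.fst.comp (Primrec.fst.comp .fst)
    have hn : Primrec fun q : ((ℕ × ℕ) × ℕ) × (ℕ × ℕ) => q.1.1.2 :=
      Primrec.snd.comp (Primrec.fst.comp .fst)
    have hsub : PrimrecPred fun r : (((ℕ × ℕ) × ℕ) × (ℕ × ℕ)) × ℕ => r.2 ∈ bits r.1.1.1.1 :=
      primrecRel_bits.comp .snd (hU.comp .fst)
    exact (SigmaIn.of_primrec (Primrec.nat_le.comp hs hn)).and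
      ((SigmaIn.of_primrec (Primrec.eq.comp hu (.const 0)).not).and
      ((SigmaIn.forall_mem_bits (P := fun (q : ((ℕ × ℕ) × ℕ) × (ℕ × ℕ)) i => i ∈ bits q.1.1.1)
        (.of_primrec hsub) hu).and
      (hΨ.comp ((primrec_pre_bits.comp hz hs).pair hu))))
  have h2 : Primrec fun q : ℕ × ℕ => 2 ^ q.2 := primrec₂_pow.comp (.const 2) .snd
  -- The property of `U` to be tested: within use `n`, every oracle meets `Ψ` with a nonempty subset
  -- of `U`. If `g` is constantly `y` on `U`, it is so on those subsets.
  have hQ : SigmaIn D fun U => ∃ n, ∀ z < 2 ^ n, ∃ p : ℕ × ℕ, K (((U, n), z), p) :=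
    SigmaIn.exists_nat (P := fun U n => ∀ z < 2 ^ n, ∃ p : ℕ × ℕ, K (((U, n), z), p))
      (SigmaIn.forall_lt (P := fun (q : ℕ × ℕ) z => ∃ p : ℕ × ℕ, K ((q, z), p))
        (SigmaIn.ex (P := fun (r : (ℕ × ℕ) × ℕ) (p : ℕ × ℕ) => K (r, p)) hK) h2)
  obtain ⟨U, -, hUy, n, hn⟩ | ⟨x, hx⟩ := isHypersurjectiveFor_iff.1 hD _ hQ y hy
  · refine .inl ⟨n, fun Z => ?_⟩
    obtain ⟨z, hz, hzZ⟩ := exists_bits_eq Z n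
    obtain ⟨⟨s, u⟩, hs, hu, huU, hΨu⟩ := hn z hz
    refine ⟨s, hs, u, hu, fun i hi => hUy i (huU i hi), ?_⟩
    rwa [pre_congr fun i hi => ?_]
    simp only at hs
    simp [hzZ, show i < n by omega]
  · refine .inr ⟨x, ?_⟩
    by_contra hcon
    push Not at hcon
    obtain ⟨n, hn⟩ := exists_bound_of_forall_exists
      (B := fun σ => ∃ u, u ≠ 0 ∧ (∀ i ∈ bits u, x < i) ∧ Ψ (σ, u)) hcon
    choose s hs u hu hxu hΨu using hn
    -- If no oracle avoids `Ψ` beyond `x`, the union of the witnesses for all `2 ^ n` truncated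
    -- oracles is a set beyond `x` with the tested property.
    let U : Finset ℕ := (Finset.range (2 ^ n)).biUnion fun z => (u (bits z)).bitIndices.toFinset
    have hmem (i : ℕ) : i ∈ U ↔ ∃ z < 2 ^ n, i ∈ bits (u (bits z)) := by simp [U, mem_bits]
    have hsub (z : ℕ) (hz : z < 2 ^ n) (i : ℕ) (hi : i ∈ bits (u (bits z))) :
        i ∈ bits (finsetCode U) := by
      rw [bits_finsetCode]
      exact (hmem i).2 ⟨z, hz, hi⟩
    refine hx (finsetCode U) ?_ ?_ ⟨n, fun z hz => ⟨(s (bits z), u (bits z)), hs _, hu _,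
      hsub z hz, hΨu _⟩⟩
    · obtain ⟨i, hi⟩ := bits_nonempty.2 (hu (bits 0))
      exact bits_nonempty.1 ⟨i, hsub 0 (by positivity) i hi⟩
    · intro i hi
      rw [bits_finsetCode] at hi
      obtain ⟨z, -, hz⟩ := (hmem i).1 hi
      exact hxu _ i hz

/-- The conditions of the forcing that finds a good member of a `Π⁰₁` class: complements of
nonempty `Π⁰₁` classes relative to `D`, given by the strings that leave the class. -/
abbrev ClassCondition (D : Set ℕ) : Type :=
  {B : List Bool → Prop // SigmaIn D B ∧ ∃ Z : Set ℕ, ∀ s, ¬ B (pre Z s)}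

/-- The dichotomy is applied to `B ∨ Φ`. Members of the class never satisfy `B`, so the first case
meets `Φ` itself. In the second case the class shrinks to the oracles that avoid `Φ` beyond `x`. -/
lemma IsHypersurjectiveFor.exists_classCondition_ge {D : Set ℕ} {g : ℕ → ℕ} {L : Set ℕ}
    (hD : IsHypersurjectiveFor D g L) {Φ : List Bool × ℕ → Prop} (hΦ : SigmaIn D Φ) {y : ℕ}
    (hy : y ∈ L) (B : ClassCondition D) :
    ∃ B' ≥ B, ∀ Z : Set ℕ, (∀ s, ¬ B'.1 (pre Z s)) →
      (∃ u, u ≠ 0 ∧ (∀ i ∈ bits u, g i = y) ∧ ∃ s, Φ (pre Z s, u)) ∨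
        ∃ x, ∀ u, u ≠ 0 → (∀ i ∈ bits u, x < i) → ¬ ∃ s, Φ (pre Z s, u) := by
  obtain ⟨B, hB, hne⟩ := B
  obtain ⟨n, hn⟩ | ⟨x, Z, hZ⟩ := hD.dichotomy ((hB.comp Primrec.fst).or hΦ) hy
  · refine ⟨⟨B, hB, hne⟩, le_rfl, fun Z hZ => .inl ?_⟩
    obtain ⟨s, -, u, hu, huy, h⟩ := hn Z
    exact ⟨u, hu, huy, s, h.resolve_left (hZ s)⟩
  · refine ⟨⟨fun σ => B σ ∨ ∃ u, u ≠ 0 ∧ (∀ i ∈ bits u, x < i) ∧ Φ (σ, u), hB.or ?_, Z, ?_⟩,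
      fun σ => .inl, fun Z hZ => .inr ⟨x, ?_⟩⟩
    · refine SigmaIn.exists_nat (P := fun σ u => u ≠ 0 ∧ (∀ i ∈ bits u, x < i) ∧ Φ (σ, u))
        ((SigmaIn.of_primrec (Primrec.eq.comp .snd (.const 0)).not).and
        ((SigmaIn.forall_mem_bits (P := fun _ i => x < i) (.of_primrec
          (Primrec.nat_lt.comp (.const x) .snd)) .snd).and (hΦ.comp (Primrec.fst.pair .snd))))
    · rintro s (h | ⟨u, hu, hxu, h⟩)
      -- `2 ^ (x + 1)` codes `{x + 1}`; any nonempty set beyond `x` would serve, since `B` ignores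
      -- it.
      · refine hZ s (2 ^ (x + 1)) (by positivity) (fun i hi => ?_) (.inl h)
        rw [mem_bits, Nat.testBit_two_pow] at hi
        simp only [decide_eq_true_eq] at hi
        omega
      · exact hZ s u hu hxu (.inr h)
    · rintro u hu hxu ⟨s, h⟩
      exact hZ s (.inr ⟨u, hu, hxu, h⟩)

/-- Weak König's lemma preserves hypersurjectivity. -/
lemma IsHypersurjectiveFor.exists_avoiding {D : Set ℕ} {g : ℕ → ℕ} {L : Set ℕ}
    (hD : IsHypersurjectiveFor D g L) {B : List Bool → Prop} (hB : SigmaIn D B)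
    (hne : ∃ Z : Set ℕ, ∀ s, ¬ B (pre Z s)) :
    ∃ Z : Set ℕ, (∀ s, ¬ B (pre Z s)) ∧ IsHypersurjectiveFor (join Z D) g L := by
  let ι := {Φ : List Bool × ℕ → Prop // SigmaIn D Φ} × L
  have : Countable {Φ : List Bool × ℕ → Prop // SigmaIn D Φ} := SigmaIn.countable D
  have := Encodable.ofCountable ι
  let 𝒟 (i : ι) : Order.Cofinal (ClassCondition D) :=
    ⟨{B' | ∀ Z : Set ℕ, (∀ s, ¬ B'.1 (pre Z s)) →
      (∃ u, u ≠ 0 ∧ (∀ k ∈ bits u, g k = i.2) ∧ ∃ s, i.1.1 (pre Z s, u)) ∨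
        ∃ x, ∀ u, u ≠ 0 → (∀ k ∈ bits u, x < k) → ¬ ∃ s, i.1.1 (pre Z s, u)}, fun B => by
      obtain ⟨B', h, h'⟩ := hD.exists_classCondition_ge i.1.2 i.2.2 B
      exact ⟨B', h', h⟩⟩
  let S := Order.sequenceOfCofinals (⟨B, hB, hne⟩ : ClassCondition D) 𝒟
  have hS : Monotone S := Order.sequenceOfCofinals.monotone _ _
  obtain ⟨Z, hZ⟩ := Hypersurj.exists_avoiding (B := fun k => (S k).1)
    (fun k => hS (Nat.le_succ k)) fun k => (S k).2.2
  refine ⟨Z, hZ 0, isHypersurjectiveFor_iff.2 fun P hP y hy => ?_⟩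
  obtain ⟨Φ, hΦ, hP⟩ := hP.exists_of_join
  simp only [hP]
  exact Order.sequenceOfCofinals.encode_mem (⟨B, hB, hne⟩ : ClassCondition D) 𝒟
    (⟨Φ, hΦ⟩, ⟨y, hy⟩) Z (hZ _)

/-! ### Homogeneity and limit colors -/

/-- All pairs `x < y` of elements of `H` have color `i`. -/
def IsMono (h : ℕ → ℕ → Fin 2) (i : Fin 2) (H : Set ℕ) : Prop :=
  ∀ x ∈ H, ∀ y ∈ H, x < y → h x y = i

lemma IsMono.subset {h : ℕ → ℕ → Fin 2} {i : Fin 2} {H K : Set ℕ} (hH : IsMono h i H)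
    (hK : K ⊆ H) : IsMono h i K := fun x hx y hy => hH x (hK hx) y (hK hy)

lemma lt_of_mem_bits {u i : ℕ} (h : i ∈ bits u) : i < u :=
  Nat.lt_two_pow_self.trans_le (Nat.ge_two_pow_of_testBit h)

lemma deltaIn_color {C : Set ℕ} {h : ℕ → ℕ → Fin 2}
    (hh : ∀ i, SigmaIn C fun p : ℕ × ℕ => h p.1 p.2 = i) (n : ℕ) (i : Fin 2) :
    DeltaIn C {w | h n w = i} := by
  have hc (i : Fin 2) : SigmaIn C fun w => h n w = i :=
    (hh i).comp (f := fun w => (n, w)) (.pair (.const n) .id)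
  refine ⟨hc i, (hc (1 - i)).of_eq fun w => ?_⟩
  simp only [Set.mem_ofPred_eq]
  generalize h n w = j
  revert i j
  decide

lemma deltaIn_gt (D : Set ℕ) (n : ℕ) : DeltaIn D {w | n < w} :=
  .of_primrec (Primrec.nat_lt.comp (.const n) .id)

/-- A set can be thinned so that the colors of the pairs `{k, w}` with `k < n` do not depend on
`w`. -/
lemma exists_limit_colors {C X : Set ℕ} {h : ℕ → ℕ → Fin 2}
    (hh : ∀ i, SigmaIn C fun p : ℕ × ℕ => h p.1 p.2 = i) (hX : X.Infinite) (n : ℕ) :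
    ∃ Y ⊆ X, Y.Infinite ∧ DeltaIn (join X C) Y ∧
      ∃ Z : Set ℕ, ∀ k < n, ∀ w ∈ Y, (h k w = 1 ↔ k ∈ Z) := by
  induction n with
  | zero => exact ⟨X, subset_rfl, hX, deltaIn_join_left _ _, ∅, by simp⟩
  | succ n ih =>
    obtain ⟨Y, hYX, hY, hYd, Z, hZ⟩ := ih
    have hd (i : Fin 2) : DeltaIn (join X C) (Y ∩ {w | h n w = i}) :=
      hYd.inter ((deltaIn_color hh n i).trans (deltaIn_join_right _ _))
    by_cases hi : (Y ∩ {w | h n w = 1}).Infinite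
    · refine ⟨_, Set.inter_subset_left.trans hYX, hi, hd 1, insert n Z, fun k hk w hw => ?_⟩
      obtain rfl | hkn := eq_or_ne k n
      · exact ⟨fun _ => Set.mem_insert _ _, fun _ => hw.2⟩
      · rw [hZ k (by omega) w hw.1, Set.mem_insert_iff, or_iff_right hkn]
    · refine ⟨Y ∩ {w | h n w = 0}, Set.inter_subset_left.trans hYX, fun hfin => hY ?_, hd 0,
        Z \ {n}, fun k hk w hw => ?_⟩
      · refine (hfin.union (Set.not_infinite.1 hi)).subset fun w hw => ?_
        obtain h0 | h1 : h n w = 0 ∨ h n w = 1 := by omega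
        · exact .inl ⟨hw, h0⟩
        · exact .inr ⟨hw, h1⟩
      · obtain rfl | hkn := eq_or_ne k n
        · simp [show h k w = 0 from hw.2]
        · rw [hZ k (by omega) w hw.1]
          simp [hkn]

/-! ### The forcing and its density lemma -/

/-- A forcing condition: codes of finite sets that are homogeneous for the two colors, and a
reservoir whose elements extend both of them and that preserves hypersurjectivity. -/
structure Condition (C : Set ℕ) (h : ℕ → ℕ → Fin 2) (g : ℕ → ℕ) (L : Set ℕ) where
  /-- The code of the homogeneous set of color `i`. -/
  F : Fin 2 → ℕ
  /-- The reservoir. -/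
  X : Set ℕ
  infinite : X.Infinite
  hyp : IsHypersurjectiveFor (join X C) g L
  isMono : ∀ i, IsMono h i (bits (F i))
  lt : ∀ i, ∀ x ∈ bits (F i), ∀ z ∈ X, x < z
  color : ∀ i, ∀ x ∈ bits (F i), ∀ z ∈ X, h x z = i

namespace Condition

variable {C : Set ℕ} {h : ℕ → ℕ → Fin 2} {g : ℕ → ℕ} {L : Set ℕ}

instance : Preorder (Condition C h g L) where
  le c d := (∀ i, bits (c.F i) ⊆ bits (d.F i) ∧ bits (d.F i) ⊆ bits (c.F i) ∪ c.X) ∧ d.X ⊆ c.X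
  le_refl c := ⟨fun i => ⟨subset_rfl, Set.subset_union_left⟩, subset_rfl⟩
  le_trans c d e hcd hde := by
    refine ⟨fun i => ⟨(hcd.1 i).1.trans (hde.1 i).1, (hde.1 i).2.trans ?_⟩, hde.2.trans hcd.2⟩
    exact Set.union_subset (hcd.1 i).2 (hcd.2.trans Set.subset_union_right)

/-- The condition `c` decides for color `i` the instance of hypersurjectivity given by the
`Σ⁰₁` property with the use relation `Φ`, and the value `y`. -/
def Decides (c : Condition C h g L) (i : Fin 2) (Φ : List Bool × ℕ → Prop) (y : ℕ) : Prop :=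
  (∃ u, u ≠ 0 ∧ (∀ k ∈ bits u, g k = y) ∧
    -- The use `s` lies below the reservoir, so no extension of `c` can change these bits.
    ∃ s, (∀ z ∈ c.X, s ≤ z) ∧ Φ (pre (bits (c.F i)) s, u)) ∨
  ∃ x, ∀ u, u ≠ 0 → (∀ k ∈ bits u, x < k) → ∀ E : Set ℕ, bits (c.F i) ⊆ E →
    E ⊆ bits (c.F i) ∪ c.X → IsMono h i E → ∀ s, ¬ Φ (pre E s, u)

/-- The finite set coded by `e` is a homogeneous extension of `c` for color `i` whose new
elements have color `i` according to `σ`. -/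
def Extends (c : Condition C h g L) (i : Fin 2) (σ : List Bool) (e : ℕ) : Prop :=
  (∀ k ∈ bits e, k ∈ bits (c.F i) ∨ (k ∈ c.X ∧ σ[k]? = some (decide (i = 1)))) ∧
    (∀ k ∈ bits (c.F i), k ∈ bits e) ∧ IsMono h i (bits e)

lemma sigmaIn_extends (hh : ∀ i, SigmaIn C fun p : ℕ × ℕ => h p.1 p.2 = i)
    (c : Condition C h g L) (i : Fin 2) :
    SigmaIn (join c.X C) fun p : List Bool × ℕ => c.Extends i p.1 p.2 := by
  have hX : SigmaIn (join c.X C) (· ∈ c.X) := (deltaIn_join_left _ _).1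
  have h1 : SigmaIn (join c.X C) fun q : (List Bool × ℕ) × ℕ =>
      q.2 ∈ bits (c.F i) ∨ (q.2 ∈ c.X ∧ q.1.1[q.2]? = some (decide (i = 1))) :=
    (SigmaIn.of_primrec (primrecRel_bits.comp .snd (.const _))).or ((hX.comp .snd).and
      (.of_primrec (Primrec.eq.comp
        (Primrec.list_getElem?.comp (Primrec.fst.comp .fst) .snd) (.const _))))
  have h2 : SigmaIn (join c.X C) fun q : (List Bool × ℕ) × ℕ => q.2 ∈ bits q.1.2 :=
    .of_primrec (primrecRel_bits.comp .snd (Primrec.snd.comp .fst))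
  have h3 : SigmaIn (join c.X C) fun q : ((List Bool × ℕ) × ℕ) × ℕ =>
      q.1.2 < q.2 → h q.1.2 q.2 = i := by
    refine ((SigmaIn.of_primrec (P := fun q : ((List Bool × ℕ) × ℕ) × ℕ => ¬ q.1.2 < q.2)
      (Primrec.nat_lt.comp (Primrec.snd.comp .fst) .snd).not).or
      (((hh i).trans (deltaIn_join_right c.X C)).comp
        (f := fun q : ((List Bool × ℕ) × ℕ) × ℕ => (q.1.2, q.2))
        ((Primrec.snd.comp .fst).pair .snd))).of_eq fun q => ?_
    tauto
  exact (SigmaIn.forall_mem_bits (P := fun (p : List Bool × ℕ) k => k ∈ bits (c.F i) ∨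
      (k ∈ c.X ∧ p.1[k]? = some (decide (i = 1)))) h1 .snd).and
    ((SigmaIn.forall_mem_bits (P := fun (p : List Bool × ℕ) k => k ∈ bits p.2) h2 (.const _)).and
    (SigmaIn.forall_mem_bits (P := fun (p : List Bool × ℕ) x => ∀ y ∈ bits p.2, x < y → h x y = i)
      (SigmaIn.forall_mem_bits (P := fun (q : (List Bool × ℕ) × ℕ) y => q.2 < y → h q.2 y = i) h3
        (Primrec.snd.comp .fst)) .snd))

/-- On `Y` the guess `Z` is correct below `n`, so each new element of `e` has color `i` with all of
`Y`, and `e` may replace `F i`. -/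
lemma exists_ge_decides_of_extends (c : Condition C h g L) {Y Z : Set ℕ} {n m s e u y : ℕ} {i : Fin 2}
    {Φ : List Bool × ℕ → Prop} (hYX : Y ⊆ c.X) (hY : Y.Infinite) (hYd : DeltaIn (join c.X C) Y)
    (hZ : ∀ k < n, ∀ w ∈ Y, (h k w = 1 ↔ k ∈ Z)) (hm : m ≤ n) (hu : u ≠ 0)
    (huy : ∀ k ∈ bits u, g k = y) (he : c.Extends i (pre Z m) e) (hΦ : Φ (pre (bits e) s, u)) :
    ∃ d ≥ c, d.Decides i Φ y := by
  obtain ⟨h1, h2, h3⟩ := he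
  let d : Condition C h g L :=
    { F := Function.update c.F i e
      -- The code `e` bounds the elements of its set, and `s` is the use to be protected.
      X := Y ∩ {w | e + s < w}
      infinite := by
        refine fun hfin => hY ((hfin.union (Set.finite_Iic (e + s))).subset fun w hw => ?_)
        by_cases hws : e + s < w
        · exact .inl ⟨hw, hws⟩
        · exact .inr (not_lt.1 hws)
      hyp := c.hyp.of_deltaIn
        ((hYd.inter (deltaIn_gt _ _)).join (deltaIn_join_right _ _))
      isMono := fun j => by
        obtain rfl | hj := eq_or_ne j i
        · simpa using h3
        · simpa [hj] using c.isMono j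
      lt := fun j x hx z hz => by
        obtain rfl | hj := eq_or_ne j i
        · have := lt_of_mem_bits (show x ∈ bits e by simpa using hx)
          have := hz.2
          simp only [Set.mem_ofPred_eq] at this
          omega
        · exact c.lt j x (by simpa [hj] using hx) z (hYX hz.1)
      color := fun j x hx z hz => by
        obtain rfl | hj := eq_or_ne j i
        · obtain hk | ⟨-, hk⟩ := h1 x (by simpa using hx)
          · exact c.color j x hk z (hYX hz.1)
          · rw [getElem?_pre] at hk
            have h5 := hZ x (hk.1.trans_le hm) z hz.1
            rw [← hk.2, decide_eq_true_eq] at h5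
            omega
        · exact c.color j x (by simpa [hj] using hx) z (hYX hz.1) }
  refine ⟨d, ⟨fun j => ?_, Set.inter_subset_left.trans hYX⟩, .inl ⟨u, hu, huy, s, ?_, ?_⟩⟩
  · obtain rfl | hj := eq_or_ne j i
    · simp only [d, Function.update_self]
      exact ⟨h2, fun k hk => (h1 k hk).imp_right And.left⟩
    · simp [d, hj]
  · rintro z ⟨-, hz⟩
    simp only [Set.mem_ofPred_eq] at hz
    omega
  · simpa [d] using hΦ

/-- Shrink the reservoir to an infinite side of `Z`. A later homogeneous set meeting the property
would have a finite truncation that extends `c` along `Z`, which is excluded. -/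
lemma exists_ge_decides_of_avoiding (c : Condition C h g L) {Z : Set ℕ} {x y : ℕ}
    {Φ : Fin 2 → List Bool × ℕ → Prop} (hZh : IsHypersurjectiveFor (join Z (join c.X C)) g L)
    (hZ : ∀ t u i e s, u ≠ 0 → (∀ k ∈ bits u, x < k) → c.Extends i (pre Z t) e →
      ¬ Φ i (pre (bits e) s, u)) :
    ∃ d ≥ c, ∃ i, d.Decides i (Φ i) y := by
  have hinf : ∃ i : Fin 2, (c.X ∩ {k | i = 1 ↔ k ∈ Z}).Infinite := by
    by_contra! hcon
    refine c.infinite (((hcon 0).union (hcon 1)).subset fun k hk => ?_)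
    by_cases hkZ : k ∈ Z
    · exact .inr ⟨hk, by simpa using hkZ⟩
    · exact .inl ⟨hk, by simpa using hkZ⟩
  obtain ⟨i, hi⟩ := hinf
  have hX : DeltaIn (join Z (join c.X C)) c.X :=
    (deltaIn_join_left _ _).trans (deltaIn_join_right _ _)
  have hC : DeltaIn (join Z (join c.X C)) C :=
    (deltaIn_join_right _ _).trans (deltaIn_join_right _ _)
  have hd : DeltaIn (join Z (join c.X C)) {k | i = 1 ↔ k ∈ Z} := by
    by_cases h1 : i = 1
    · simpa [h1] using deltaIn_join_left Z (join c.X C)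
    · convert (deltaIn_join_left Z (join c.X C)).compl using 1
      ext k
      simp [h1]
  let d : Condition C h g L :=
    { F := c.F
      X := c.X ∩ {k | i = 1 ↔ k ∈ Z}
      infinite := hi
      hyp := hZh.of_deltaIn ((hX.inter hd).join hC)
      isMono := c.isMono
      lt := fun j x hx z hz => c.lt j x hx z hz.1
      color := fun j x hx z hz => c.color j x hx z hz.1 }
  refine ⟨d, ⟨fun j => ⟨subset_rfl, Set.subset_union_left⟩, Set.inter_subset_left⟩, i,
    .inr ⟨x, fun u hu hxu E hFE hEF hE s hΦ => ?_⟩⟩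
  -- Truncating at `s` keeps the use, and at the code `c.F i` keeps every element of that set.
  obtain ⟨e, -, he⟩ := exists_bits_eq E (max s (c.F i))
  refine hZ (max s (c.F i)) u i e s hu hxu ⟨fun k hk => ?_, fun k hk => ?_,
    hE.subset fun k hk => ((he k).1 hk).2⟩ ?_
  · obtain ⟨hkt, hkE⟩ := (he k).1 hk
    refine (hEF hkE).imp_right fun hkX => ⟨hkX.1, ?_⟩
    rw [getElem?_pre, decide_eq_true_eq]
    exact ⟨hkt, hkX.2⟩
  · exact (he k).2 ⟨(lt_of_mem_bits hk).trans_le (le_max_right _ _), hFE hk⟩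
  · rwa [pre_congr fun k hk => ?_]
    rw [he, and_iff_right (hk.trans_le (le_max_left _ _))]

lemma exists_ge_decides (hh : ∀ i, SigmaIn C fun p : ℕ × ℕ => h p.1 p.2 = i)
    (c : Condition C h g L) {Φ : Fin 2 → List Bool × ℕ → Prop} (hΦ : ∀ i, SigmaIn C (Φ i))
    {y : ℕ} (hy : y ∈ L) : ∃ d ≥ c, ∃ i, d.Decides i (Φ i) y := by
  let M (i : Fin 2) (p : List Bool × ℕ) (q : ℕ × ℕ) : Prop :=
    c.Extends i p.1 q.1 ∧ Φ i (pre (bits q.1) q.2, p.2)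
  have hM (i : Fin 2) : SigmaIn (join c.X C) fun p => ∃ q, M i p q :=
    SigmaIn.ex (P := M i) (((c.sigmaIn_extends hh i).comp
      (f := fun r : (List Bool × ℕ) × (ℕ × ℕ) => (r.1.1, r.2.1))
      ((Primrec.fst.comp .fst).pair (Primrec.fst.comp .snd))).and
      (((hΦ i).trans (deltaIn_join_right c.X C)).comp
      (f := fun r : (List Bool × ℕ) × (ℕ × ℕ) => (pre (bits r.2.1) r.2.2, r.1.2))
      ((primrec_pre_bits.comp (Primrec.fst.comp .snd) (Primrec.snd.comp .snd)).pair
        (Primrec.snd.comp .fst))))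
  have hΨ := (hM 0).or (hM 1)
  obtain ⟨n, hn⟩ | ⟨x, Z, hZ⟩ := c.hyp.dichotomy hΨ hy
  · obtain ⟨Y, hYX, hY, hYd, Z, hZ⟩ := exists_limit_colors hh c.infinite n
    obtain ⟨m, hm, u, hu, huy, ⟨⟨e, s⟩, h1, h2⟩ | ⟨⟨e, s⟩, h1, h2⟩⟩ := hn Z
    · obtain ⟨d, hd, h⟩ :=
        c.exists_ge_decides_of_extends hYX hY hYd hZ hm hu huy h1 h2
      exact ⟨d, hd, 0, h⟩
    · obtain ⟨d, hd, h⟩ :=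
        c.exists_ge_decides_of_extends hYX hY hYd hZ hm hu huy h1 h2
      exact ⟨d, hd, 1, h⟩
  · have hB : SigmaIn (join c.X C) fun σ => ∃ u, u ≠ 0 ∧ (∀ i ∈ bits u, x < i) ∧
        ((∃ q, M 0 (σ, u) q) ∨ ∃ q, M 1 (σ, u) q) :=
      SigmaIn.exists_nat (P := fun σ u => u ≠ 0 ∧ (∀ i ∈ bits u, x < i) ∧
        ((∃ q, M 0 (σ, u) q) ∨ ∃ q, M 1 (σ, u) q))
        ((SigmaIn.of_primrec (Primrec.eq.comp .snd (.const 0)).not).and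
        ((SigmaIn.forall_mem_bits (P := fun _ i => x < i) (.of_primrec
          (Primrec.nat_lt.comp (.const x) .snd)) .snd).and hΨ))
    obtain ⟨Z, hZ, hZh⟩ := c.hyp.exists_avoiding hB
      ⟨Z, fun s ⟨u, hu, hxu, H⟩ => hZ s u hu hxu H⟩
    refine c.exists_ge_decides_of_avoiding hZh fun t u i e s hu hxu h1 h2 => hZ t ⟨u, hu, hxu, ?_⟩
    obtain rfl | rfl : i = 0 ∨ i = 1 := by omega
    · exact .inl ⟨(e, s), h1, h2⟩
    · exact .inr ⟨(e, s), h1, h2⟩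

/-- The homogeneous set of color `i` built along a sequence of conditions. -/
def limit (S : ℕ → Condition C h g L) (i : Fin 2) : Set ℕ := ⋃ n, bits ((S n).F i)

variable {S : ℕ → Condition C h g L} {i : Fin 2}

lemma bits_subset_limit (n : ℕ) : bits ((S n).F i) ⊆ limit S i :=
  Set.subset_iUnion (fun n => bits ((S n).F i)) n

lemma limit_subset (hS : Monotone S) (n : ℕ) : limit S i ⊆ bits ((S n).F i) ∪ (S n).X := by
  refine Set.iUnion_subset fun m => ?_
  obtain hmn | hnm := le_total m n
  · exact ((hS hmn).1 i).1.trans Set.subset_union_left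
  · exact ((hS hnm).1 i).2

lemma isMono_limit (hS : Monotone S) : IsMono h i (limit S i) := by
  intro x hx y hy hxy
  obtain ⟨m, hm⟩ := Set.mem_iUnion.1 hx
  obtain ⟨n, hn⟩ := Set.mem_iUnion.1 hy
  exact (S (max m n)).isMono i x (((hS (le_max_left m n)).1 i).1 hm) y
    (((hS (le_max_right m n)).1 i).1 hn) hxy

lemma infinite_limit {y : ℕ}
    (hdec : ∀ Φ : List Bool × ℕ → Prop, SigmaIn C Φ → ∃ n, (S n).Decides i Φ y) :
    (limit S i).Infinite := by
  refine Set.infinite_of_not_bddAbove fun ⟨b, hb⟩ => ?_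
  have hΦ : SigmaIn C fun p : List Bool × ℕ => ∃ j, b < j ∧ p.1[j]? = some true :=
    SigmaIn.exists_nat (P := fun (p : List Bool × ℕ) j => b < j ∧ p.1[j]? = some true)
      (.of_primrec ((Primrec.nat_lt.comp (.const b) .snd).and
        (Primrec.eq.comp (Primrec.list_getElem?.comp (Primrec.fst.comp .fst) .snd) (.const _))))
  obtain ⟨n, ⟨u, -, -, s, -, j, hj, hjs⟩ | ⟨x, hx⟩⟩ := hdec _ hΦ
  · have := hb (bits_subset_limit n ((getElem?_pre.1 hjs).2.1 rfl))
    omega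
  · obtain ⟨z, hz, hbz⟩ := (S n).infinite.exists_gt b
    refine hx (2 ^ (x + 1)) (by positivity) (fun k hk => ?_) (insert z (bits ((S n).F i)))
      (Set.subset_insert _ _) (Set.insert_subset (.inr hz) Set.subset_union_left) ?_ (z + 1)
      ⟨z, hbz, getElem?_pre.2 ⟨z.lt_succ_self, by simp⟩⟩
    · rw [mem_bits, Nat.testBit_two_pow] at hk
      simp only [decide_eq_true_eq] at hk
      omega
    · rintro p (rfl | hp) q (rfl | hq) hpq
      · omega
      · have := (S n).lt i q hq p hz
        omega
      · exact (S n).color i p hp q hz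
      · exact (S n).isMono i p hp q hq hpq

lemma isHypersurjectiveFor_limit (hS : Monotone S) {L' : Set ℕ}
    (hdec : ∀ y ∈ L', ∀ Φ : List Bool × ℕ → Prop, SigmaIn C Φ → ∃ n, (S n).Decides i Φ y) :
    IsHypersurjectiveFor (join (limit S i) C) g L' := by
  refine isHypersurjectiveFor_iff.2 fun P hP y hy => ?_
  obtain ⟨Φ, hΦ, hP⟩ := hP.exists_of_join
  obtain ⟨n, ⟨u, hu, huy, s, hs, H⟩ | ⟨x, hx⟩⟩ := hdec y hy Φ hΦ
  · refine .inl ⟨u, hu, huy, (hP u).2 ⟨s, ?_⟩⟩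
    rwa [pre_congr fun k hk => ⟨fun hkl => ?_, fun hkF => bits_subset_limit n hkF⟩]
    exact (limit_subset hS n hkl).resolve_right fun hkX => absurd (hs k hkX) (by omega)
  · refine .inr ⟨x, fun u hu hxu hPu => ?_⟩
    obtain ⟨s, H⟩ := (hP u).1 hPu
    exact hx u hu hxu _ (bits_subset_limit n) (limit_subset hS n) (isMono_limit hS) s H

/-- The condition with empty homogeneous sets and full reservoir. -/
def initial (hC : IsHypersurjectiveFor C g L) : Condition C h g L where
  F _ := 0
  X := Set.univ
  infinite := Set.infinite_univ
  hyp := hC.of_deltaIn ((DeltaIn.of_primrec 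
    (.of_eq (Primrec.eq.comp .id .id) (by simp))).join (.refl C))
  isMono _ x hx := absurd hx (by simp [mem_bits])
  lt _ x hx := absurd hx (by simp [mem_bits])
  color _ x hx := absurd hx (by simp [mem_bits])

lemma exists_sequence (hh : ∀ i, SigmaIn C fun p : ℕ × ℕ => h p.1 p.2 = i)
    (hC : IsHypersurjectiveFor C g L) :
    ∃ S : ℕ → Condition C h g L, Monotone S ∧ ∀ Φ : Fin 2 → List Bool × ℕ → Prop,
      (∀ i, SigmaIn C (Φ i)) → ∀ y ∈ L, ∃ n i, (S n).Decides i (Φ i) y := by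
  let ι := (Fin 2 → {Φ : List Bool × ℕ → Prop // SigmaIn C Φ}) × L
  have : Countable {Φ : List Bool × ℕ → Prop // SigmaIn C Φ} := SigmaIn.countable C
  have := Encodable.ofCountable ι
  let 𝒟 (r : ι) : Order.Cofinal (Condition C h g L) :=
    ⟨{d | ∃ i, d.Decides i (r.1 i).1 r.2}, fun c => by
      obtain ⟨d, hd, hd'⟩ := c.exists_ge_decides hh (fun i => (r.1 i).2) r.2.2
      exact ⟨d, hd', hd⟩⟩
  exact ⟨_, Order.sequenceOfCofinals.monotone (initial hC) 𝒟, fun Φ hΦ y hy =>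
    ⟨_, Order.sequenceOfCofinals.encode_mem (initial hC) 𝒟 (fun i => ⟨Φ i, hΦ i⟩, ⟨y, hy⟩)⟩⟩

end Condition

lemma exists_isMono_isHypersurjective {C : Set ℕ} {h : ℕ → ℕ → Fin 2} {g : ℕ → ℕ}
    (hh : ∀ i, SigmaIn C fun p : ℕ × ℕ => h p.1 p.2 = i) (hg : IsHypersurjective C g) :
    ∃ H : Set ℕ, H.Infinite ∧ (∃ i, IsMono h i H) ∧ IsHypersurjective (join H C) g := by
  obtain ⟨L, hL, hC⟩ := hg
  obtain ⟨S, hS, hdec⟩ := Condition.exists_sequence hh hC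
  let M (i : Fin 2) : Set ℕ :=
    {y ∈ L | ∀ Φ : List Bool × ℕ → Prop, SigmaIn C Φ → ∃ n, (S n).Decides i Φ y}
  have hLM : L ⊆ M 0 ∪ M 1 := by
    intro y hy
    by_contra hcon
    simp only [M, Set.mem_union, Set.mem_sep_iff, hy, true_and, not_or] at hcon
    push Not at hcon
    obtain ⟨⟨Φ, hΦ, h0⟩, Φ', hΦ', h1⟩ := hcon
    obtain ⟨n, i, hi⟩ := hdec ![Φ, Φ'] (by simp [Fin.forall_fin_two, hΦ, hΦ']) y hy
    obtain rfl | rfl : i = 0 ∨ i = 1 := by omega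
    · exact h0 n hi
    · exact h1 n hi
  have hM : ∃ i, (M i).Infinite := by
    by_contra! hcon
    exact hL (((hcon 0).union (hcon 1)).subset hLM)
  obtain ⟨i, hi⟩ := hM
  obtain ⟨y, hy⟩ := hi.nonempty
  exact ⟨Condition.limit S i, Condition.infinite_limit hy.2, ⟨i, Condition.isMono_limit hS⟩,
    M i, hi, Condition.isHypersurjectiveFor_limit hS fun y hy => hy.2⟩

end Hypersurj

theorem mainTheorem4 (C : Set ℕ) (g : ℕ → ℕ) (hg : Hypersurj.IsHypersurjective C g)
    (f : Hypersurj.PairColoring) (hf : f.IsComputableIn C) :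
    ∃ H : Set ℕ, H.Infinite ∧ f.IsHomogeneous H ∧
      Hypersurj.IsHypersurjective (Hypersurj.join H C) g := by
  obtain ⟨h, hh, hfh⟩ := hf
  obtain ⟨H, hH, ⟨i, hi⟩, hHg⟩ := Hypersurj.exists_isMono_isHypersurjective (h := h)
    (fun i => (Hypersurj.SigmaIn.graph hh).comp (f := fun p => (p, i)) (.pair .id (.const i))) hg
  refine ⟨H, hH, ⟨i, ?_⟩, hHg⟩
  have key {x y : ℕ} (hxy : x < y) (hx : x ∈ H) (hy : y ∈ H) :
      f ⟨{x, y}, Finset.card_pair hxy.ne⟩ = i :=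
    (hfh x y hxy).trans (hi x hx y hy hxy)
  rintro ⟨s, hs⟩ hsH
  obtain ⟨x, y, hxy, rfl⟩ := Finset.card_eq_two.1 hs
  have hx : x ∈ H := hsH (by simp)
  have hy : y ∈ H := hsH (by simp)
  obtain hlt | hlt := lt_or_gt_of_ne hxy
  · exact key hlt hx hy
  · convert key hlt hy hx using 3
    exact Finset.pair_comm x y
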